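/- Let $d$ be a dimension and let $b:\mathbb{R}^d\to\mathbb{R}^d$ be differentiable such that, for constants $L_b,C>0$ and all $x,y\in\mathbb{R}^d$, $$|b(x)-b(y)|\le L_b|x-y|,\qquad |\nabla b(x)-\nabla b(y)|\le C|x-y|,$$ where $|\cdot|$ is the Euclidean norm on $\mathbb{R}^d$ and the associated operator norm on matrices. Let $T,\delta,c>0$ with $$\delta\le\frac{1}{16\,c\,L_b^2\,e^{2cL_b}},$$ and let $Q$ be the transition kernel on $\mathbb{R}^d$ of the Euler scheme $$X_{k+1}=X_k+\delta\, b(X_k)+\sqrt{2T\delta}\,Z_{k+1},$$ with $(Z_k)$ i.i.d. standard Gaussian vectors in $\mathbb{R}^d$. Let $\pi_\infty$ be an invariant probability measure of $Q$. Then for every probability measure $\nu$ on $\mathbb{R}^d$ and every integer $n\ge 2$ with $n\delta<c$, $$\mathcal{H}(\nu Q^n\,|\,\pi_\infty)\le\left(\frac{1}{2T}\Big(n\delta L_b^2+\frac{1}{n\delta}\Big)+\frac12 c^2C^2 d\,e^{2cL_b}\right)\mathcal{W}_2^2(\nu,\pi_\infty).$$ Here $\mathcal{H}(\mu|\pi)=\int\log\frac{d\mu}{d\pi}\,d\mu\in[0,\infty]$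 is the relative entropy ($+\infty$ if $\mu\not\ll\pi$), and $\mathcal{W}_2(\mu,\nu)=\big(\inf_\gamma\int|x-y|^2\,d\gamma(x,y)\big)^{1/2}\in[0,\infty]$, the infimum being over all couplings $\gamma$ of $\mu$ and $\nu$. -/

import Mathlib

open MeasureTheory ProbabilityTheory
open scoped ENNReal

/-- The transition kernel of the Euler scheme
`X_{k+1} = X_k + δ b(X_k) + √(2Tδ) Z_{k+1}` on `ℝ^d`, with `Z_{k+1}` standard Gaussian:
`Q(x, ·)` is the law of `x + δ b(x) + √(2Tδ) Z`. -/
noncomputable def eulerKernel {d : ℕ}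
    (b : EuclideanSpace ℝ (Fin d) → EuclideanSpace ℝ (Fin d)) (hb : Measurable b) (δ T : ℝ) :
    Kernel (EuclideanSpace ℝ (Fin d)) (EuclideanSpace ℝ (Fin d)) where
  toFun x := (stdGaussian (EuclideanSpace ℝ (Fin d))).map
    (fun z => x + δ • b x + √(2 * T * δ) • z)
  measurable' := by
    refine Measure.measurable_of_measurable_coe _ fun s hs => ?_
    have hmap : ∀ x : EuclideanSpace ℝ (Fin d), Measurable
        (fun z : EuclideanSpace ℝ (Fin d) => x + δ • b x + √(2 * T * δ) • z) :=
      fun x => by fun_prop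
    have hjoint : Measurable
        (fun p : EuclideanSpace ℝ (Fin d) × EuclideanSpace ℝ (Fin d) =>
          p.1 + δ • b p.1 + √(2 * T * δ) • p.2) := by fun_prop
    simp_rw [Measure.map_apply (hmap _) hs]
    exact measurable_measure_prodMk_left (hjoint hs)

instance isMarkovKernel_eulerKernel {d : ℕ}
    (b : EuclideanSpace ℝ (Fin d) → EuclideanSpace ℝ (Fin d)) (hb : Measurable b) (δ T : ℝ) :
    IsMarkovKernel (eulerKernel b hb δ T) where
  isProbabilityMeasure x :=
    Measure.isProbabilityMeasure_map
      (f := fun z : EuclideanSpace ℝ (Fin d) => x + δ • b x + √(2 * T * δ) • z) (by fun_prop)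

/-- The couplings of `μ` and `ν`: measures on the product with marginals `μ` and `ν`. -/
def couplings {E : Type*} [MeasurableSpace E] (μ ν : Measure E) : Set (Measure (E × E)) :=
  {γ | γ.map Prod.fst = μ ∧ γ.map Prod.snd = ν}

/-- The `L^p`-Wasserstein distance
`W_p(μ, ν) = (inf_γ ∫ |x - y|^p dγ(x, y))^{1/p}`, with values in `[0, ∞]`. -/
noncomputable def wassersteinDist {E : Type*} [MeasurableSpace E] [EDist E]
    (p : ℝ) (μ ν : Measure E) : ℝ≥0∞ :=
  (⨅ γ ∈ couplings μ ν, ∫⁻ z, edist z.1 z.2 ^ p ∂γ) ^ (1 / p)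

/-! Fix a coupling of `ν` and `πinf`, draw `(x, y)` from it, and run the Euler chain `W` from `x`,
keeping `(x, y)` as a label. The interpolation `W k + θ k • (y - x)` with `θ k = 1 - k / n` starts
at `y` and ends at `W n`, so its law moves from that of the chain started at `y` to that of the
chain started at `x`. Each of its steps is an Euler step whose Gaussian noise is shifted by a
function of the labelled state. By Cameron–Martin and the chain rule, such a step adds at most half
the mean squared shift to the relative entropy (`klDiv_map_prod_stdGaussian_shift_le`). The
Lipschitz bound makes each shift `O(‖x - y‖)`. Summing over `n` steps, forgetting the label by data
processing and using invariance of `πinf` gives the bound for this coupling; the infimum over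
couplings gives `W₂`. -/

/-! ### Gaussian shifts and their entropic cost. -/

section GaussianShift

variable {E : Type*} [NormedAddCommGroup E] [InnerProductSpace ℝ E] [FiniteDimensional ℝ E]
  [MeasurableSpace E] [BorelSpace E]

open scoped RealInnerProductSpace

/-- The joint Laplace and Fourier transform of the standard Gaussian measure. -/
lemma integral_cexp_inner_add_inner_mul_I_stdGaussian (a t : E) :
    ∫ z, Complex.exp ((⟪a, z⟫ : ℂ) + (⟪z, t⟫ : ℂ) * Complex.I) ∂(stdGaussian E) =
      Complex.exp (((‖a‖ ^ 2 : ℝ) : ℂ) / 2 - ((‖t‖ ^ 2 : ℝ) : ℂ) / 2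
        + (⟪a, t⟫ : ℂ) * Complex.I) := by
  set e := stdOrthonormalBasis ℝ E
  have h1 (s : ℂ) : ∫ x : ℝ, Complex.exp (s * x) ∂(gaussianReal 0 1) = Complex.exp (s ^ 2 / 2) := by
    have := complexMGF_id_gaussianReal (μ := 0) (v := 1) s
    simpa [complexMGF] using this
  have hrw (x : Fin (Module.finrank ℝ E) → ℝ) :
      Complex.exp ((⟪a, ∑ i, x i • e i⟫ : ℂ) + (⟪∑ i, x i • e i, t⟫ : ℂ) * Complex.I) =
        ∏ i, Complex.exp (((⟪a, e i⟫ : ℂ) + (⟪e i, t⟫ : ℂ) * Complex.I) * x i) := by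
    rw [← Complex.exp_sum]
    congr 1
    simp only [sum_inner, inner_sum, real_inner_smul_left, real_inner_smul_right,
      Complex.ofReal_sum, Complex.ofReal_mul, Finset.sum_mul, ← Finset.sum_add_distrib]
    exact Finset.sum_congr rfl fun i _ => by ring
  rw [stdGaussian, integral_map (Measurable.aemeasurable (by fun_prop))
    (Measurable.aestronglyMeasurable (by fun_prop))]
  refine (integral_congr_ae (Filter.Eventually.of_forall hrw)).trans ?_
  rw [integral_fintype_prod_eq_prod
    (f := fun i (x : ℝ) => Complex.exp (((⟪a, e i⟫ : ℂ) + (⟪e i, t⟫ : ℂ) * Complex.I) * x))]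
  simp_rw [h1]
  rw [← Complex.exp_sum, ← e.sum_sq_inner_left a, ← e.sum_sq_inner_right t,
    ← e.sum_inner_mul_inner a t]
  congr 1
  push_cast
  rw [Finset.sum_div, Finset.sum_div, Finset.sum_mul, ← Finset.sum_sub_distrib,
    ← Finset.sum_add_distrib]
  refine Finset.sum_congr rfl fun i _ => ?_
  linear_combination ((⟪e i, t⟫ : ℂ) ^ 2 / 2) * Complex.I_sq

lemma integral_exp_inner_stdGaussian (a : E) :
    ∫ z, Real.exp (⟪a, z⟫ - ‖a‖ ^ 2 / 2) ∂(stdGaussian E) = 1 := by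
  have h := integral_cexp_inner_add_inner_mul_I_stdGaussian a (0 : E)
  simp only [inner_zero_right, Complex.ofReal_zero, zero_mul, add_zero, norm_zero] at h
  have h2 : ∫ z, Real.exp ⟪a, z⟫ ∂(stdGaussian E) = Real.exp (‖a‖ ^ 2 / 2) := by
    apply Complex.ofReal_injective
    rw [← integral_complex_ofReal]
    push_cast
    rw [h]
    simp
  simp_rw [Real.exp_sub, integral_div, h2]
  exact div_self (Real.exp_pos _).ne'

lemma integrable_exp_inner_stdGaussian (a : E) :
    Integrable (fun z => Real.exp (⟪a, z⟫ - ‖a‖ ^ 2 / 2)) (stdGaussian E) := by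
  -- A non-integrable function has Bochner integral `0`, whereas this integral is `1`.
  by_contra h
  have := integral_exp_inner_stdGaussian a
  rw [integral_undef h] at this
  exact zero_ne_one this

/-- **Cameron–Martin formula** for the standard Gaussian measure. -/
lemma stdGaussian_map_add_eq_withDensity (a : E) :
    (stdGaussian E).map (fun z => z + a) =
      (stdGaussian E).withDensity fun z => ENNReal.ofReal (Real.exp (⟪a, z⟫ - ‖a‖ ^ 2 / 2)) := by
  have hfin : IsFiniteMeasure ((stdGaussian E).withDensity
      fun z => ENNReal.ofReal (Real.exp (⟪a, z⟫ - ‖a‖ ^ 2 / 2))) :=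
    isFiniteMeasure_withDensity_ofReal (integrable_exp_inner_stdGaussian a).2
  have : IsProbabilityMeasure ((stdGaussian E).map (fun z => z + a)) :=
    Measure.isProbabilityMeasure_map (by fun_prop)
  apply Measure.ext_of_charFun
  ext t
  rw [charFun_apply, charFun_apply, integral_map (by fun_prop)
      (Measurable.aestronglyMeasurable (by fun_prop)),
    integral_withDensity_eq_integral_toReal_smul (by fun_prop) (by simp)]
  have hl (z : E) : Complex.exp ((⟪z + a, t⟫ : ℂ) * Complex.I) =
      Complex.exp ((⟪a, t⟫ : ℂ) * Complex.I) *
        Complex.exp ((⟪(0 : E), z⟫ : ℂ) + (⟪z, t⟫ : ℂ) * Complex.I) := by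
    rw [← Complex.exp_add, inner_add_left, inner_zero_left]
    congr 1
    push_cast
    ring
  have hr (z : E) : (ENNReal.ofReal (Real.exp (⟪a, z⟫ - ‖a‖ ^ 2 / 2))).toReal •
      Complex.exp ((⟪z, t⟫ : ℂ) * Complex.I) = Complex.exp (-((‖a‖ ^ 2 : ℝ) : ℂ) / 2) *
        Complex.exp ((⟪a, z⟫ : ℂ) + (⟪z, t⟫ : ℂ) * Complex.I) := by
    rw [ENNReal.toReal_ofReal (Real.exp_pos _).le, Complex.real_smul, Complex.ofReal_exp,
      ← Complex.exp_add, ← Complex.exp_add]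
    congr 1
    push_cast
    ring
  simp_rw [hl, hr]
  rw [integral_const_mul, integral_const_mul, integral_cexp_inner_add_inner_mul_I_stdGaussian,
    integral_cexp_inner_add_inner_mul_I_stdGaussian, ← Complex.exp_add, ← Complex.exp_add]
  congr 1
  rw [norm_zero, inner_zero_left]
  push_cast
  ring

variable {S : Type*} [MeasurableSpace S]

/-- Shifting the Gaussian coordinate of a product measure by a function of the first coordinate
gives a measure with explicit density. -/
lemma prod_stdGaussian_map_shift_eq_withDensity (ρ : Measure S) [IsProbabilityMeasure ρ]
    {v : S → E} (hv : Measurable v) :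
    (ρ.prod (stdGaussian E)).map (fun p => (p.1, p.2 + v p.1)) =
      (ρ.prod (stdGaussian E)).withDensity
        fun p => ENNReal.ofReal (Real.exp (⟪v p.1, p.2⟫ - ‖v p.1‖ ^ 2 / 2)) := by
  refine Measure.ext_of_lintegral _ fun f hf => ?_
  rw [lintegral_map hf (by fun_prop), lintegral_withDensity_eq_lintegral_mul _ (by fun_prop) hf,
    lintegral_prod _ (by fun_prop), lintegral_prod _ (by fun_prop)]
  refine lintegral_congr fun s => ?_
  have h := congrArg (fun m => ∫⁻ z, f (s, z) ∂m) (stdGaussian_map_add_eq_withDensity (v s))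
  rw [lintegral_map (by fun_prop) (by fun_prop),
    lintegral_withDensity_eq_lintegral_mul _ (by fun_prop) (by fun_prop)] at h
  exact h

open InformationTheory in
/-- Entropic cost of a random shift of a standard Gaussian vector. -/
lemma klDiv_prod_stdGaussian_map_shift_le (ρ : Measure S) [IsProbabilityMeasure ρ]
    {v : S → E} (hv : Measurable v) :
    klDiv ((ρ.prod (stdGaussian E)).map (fun p => (p.1, p.2 + v p.1)))
      (ρ.prod (stdGaussian E)) ≤ ∫⁻ s, ENNReal.ofReal (‖v s‖ ^ 2 / 2) ∂ρ := by
  by_cases htop : ∫⁻ s, ENNReal.ofReal (‖v s‖ ^ 2 / 2) ∂ρ = ∞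
  · rw [htop]; exact le_top
  have hsq : Integrable (fun s => ‖v s‖ ^ 2 / 2) ρ :=
    (lintegral_ofReal_ne_top_iff_integrable (by fun_prop)
      (Filter.Eventually.of_forall fun s => by positivity)).1 htop
  have hv1 : Integrable v ρ := by
    have : MemLp v 2 ρ := (memLp_two_iff_integrable_sq_norm hv.aestronglyMeasurable).2 (by
      simpa using hsq.mul_const 2)
    exact this.integrable (by norm_num)
  set R := ρ.prod (stdGaussian E)
  have hmap : Measurable fun p : S × E => (p.1, p.2 + v p.1) := by fun_prop
  have hdens := prod_stdGaussian_map_shift_eq_withDensity (E := E) ρ hv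
  set P := R.map (fun p => (p.1, p.2 + v p.1))
  have : IsProbabilityMeasure P := Measure.isProbabilityMeasure_map hmap.aemeasurable
  have hac : P ≪ R := by rw [hdens]; exact withDensity_absolutelyContinuous _ _
  have hllr : llr P R =ᵐ[P] fun p => ⟪v p.1, p.2⟫ - ‖v p.1‖ ^ 2 / 2 := by
    refine hac.ae_le ?_
    have := Measure.rnDeriv_withDensity R (f := fun p : S × E =>
      ENNReal.ofReal (Real.exp (⟪v p.1, p.2⟫ - ‖v p.1‖ ^ 2 / 2))) (by fun_prop)
    rw [← hdens] at this
    filter_upwards [this] with p hp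
    rw [llr, hp, ENNReal.toReal_ofReal (Real.exp_pos _).le, Real.log_exp]
  have hinner : Integrable (fun p : S × E => ⟪v p.1, p.2⟫) R :=
    Integrable.op_fst_snd (op := fun x y : E => ⟪x, y⟫) continuous_inner
      ⟨1, fun x y => by simpa using norm_inner_le_norm (𝕜 := ℝ) x y⟩ hv1 IsGaussian.integrable_id
  have hsq' : Integrable (fun p : S × E => ‖v p.1‖ ^ 2 / 2) R := hsq.comp_fst _
  -- Under the shifted law the log-density gains `‖v‖ ^ 2`, which flips the sign of the quadratic
  -- term. The linear term has mean zero, leaving the mean of `‖v‖ ^ 2 / 2`.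
  have hcomp (p : S × E) : ⟪v p.1, p.2 + v p.1⟫ - ‖v p.1‖ ^ 2 / 2 =
      ⟪v p.1, p.2⟫ + ‖v p.1‖ ^ 2 / 2 := by
    rw [inner_add_right, real_inner_self_eq_norm_sq]; ring
  have hint : Integrable (fun p : S × E => ⟪v p.1, p.2⟫ - ‖v p.1‖ ^ 2 / 2) P := by
    rw [integrable_map_measure (Measurable.aestronglyMeasurable (by fun_prop)) hmap.aemeasurable]
    simp only [Function.comp_def, hcomp]
    exact hinner.add hsq'
  rw [klDiv_of_ac_of_integrable hac ((integrable_congr hllr).2 hint), integral_congr_ae hllr,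
    integral_map hmap.aemeasurable (Measurable.aestronglyMeasurable (by fun_prop))]
  simp only [hcomp]
  rw [integral_add hinner hsq', integral_prod _ hinner]
  have hz (s : S) : ∫ z, ⟪v s, z⟫ ∂(stdGaussian E) = 0 := by
    simpa using integral_strongDual_stdGaussian (innerSL ℝ (v s))
  simp only [hz, integral_zero, zero_add, probReal_univ, add_sub_cancel_right]
  rw [integral_prod _ hsq']
  simp only [integral_const, probReal_univ, one_smul]
  rw [ofReal_integral_eq_lintegral_ofReal hsq (Filter.Eventually.of_forall fun s => by positivity)]

open InformationTheory in
/-- One step of the shifted composition rule: the relative entropy of the images of `P` and `R`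
under a Gaussian noise, shifted in the first case, increases by at most the cost of the shift. -/
lemma klDiv_map_prod_stdGaussian_shift_le {S' : Type*} [MeasurableSpace S'] (P R : Measure S)
    [IsProbabilityMeasure P] [IsProbabilityMeasure R] {v : S → E} (hv : Measurable v)
    {F : S × E → S'} (hF : Measurable F) :
    klDiv ((P.prod (stdGaussian E)).map (fun p => F (p.1, p.2 + v p.1)))
        ((R.prod (stdGaussian E)).map F) ≤
      klDiv P R + ∫⁻ s, ENNReal.ofReal (‖v s‖ ^ 2 / 2) ∂P := by
  have hsh : Measurable fun p : S × E => p.2 + v p.1 := by fun_prop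
  -- The shifted noise as a kernel from `S`, so that the chain rule separates the entropy of the
  -- states from that of the noise.
  let κ : Kernel S E := (Kernel.id ×ₖ Kernel.const S (stdGaussian E)).map (fun p => p.2 + v p.1)
  have : IsMarkovKernel κ := Kernel.IsMarkovKernel.map _ hsh
  have hκ : P ⊗ₘ κ = (P.prod (stdGaussian E)).map (fun p => (p.1, p.2 + v p.1)) := by
    refine Measure.ext_of_lintegral _ fun f hf => ?_
    rw [Measure.lintegral_compProd hf, lintegral_map hf (by fun_prop),
      lintegral_prod _ (by fun_prop)]
    refine lintegral_congr fun s => ?_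
    rw [Kernel.map_apply _ hsh, Kernel.prod_apply, Kernel.id_apply, Kernel.const_apply,
      lintegral_map (by fun_prop) hsh, Measure.dirac_prod, lintegral_map (by fun_prop) (by fun_prop)]
  have h1 : (P.prod (stdGaussian E)).map (fun p => F (p.1, p.2 + v p.1)) = (P ⊗ₘ κ).map F := by
    rw [hκ, Measure.map_map hF (by fun_prop)]
    rfl
  rw [h1, ← Measure.compProd_const (μ := R)]
  refine (klDiv_map_le _ _ hF).trans ?_
  rw [klDiv_compProd_eq_add]
  gcongr
  rw [hκ, Measure.compProd_const]
  exact klDiv_prod_stdGaussian_map_shift_le P hv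

end GaussianShift

/-! ### The Euler chain carrying a label. -/

section LabelledEuler

variable {d : ℕ}

local notation "𝔼" => EuclideanSpace ℝ (Fin d)

/-- One step of the Euler scheme on the second coordinate, the first coordinate (a label) being
kept. -/
noncomputable def labelledEulerStep {Z : Type*} [MeasurableSpace Z] (b : 𝔼 → 𝔼) (δ T : ℝ)
    (μ : Measure (Z × 𝔼)) : Measure (Z × 𝔼) :=
  (μ.prod (stdGaussian 𝔼)).map
    fun p => (p.1.1, p.1.2 + δ • b p.1.2 + √(2 * T * δ) • p.2)

variable {Z : Type*} [MeasurableSpace Z] {b : EuclideanSpace ℝ (Fin d) → EuclideanSpace ℝ (Fin d)} {δ T : ℝ}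

lemma isProbabilityMeasure_labelledEulerStep (hb : Measurable b) (μ : Measure (Z × 𝔼)) [IsProbabilityMeasure μ] :
    IsProbabilityMeasure (labelledEulerStep b δ T μ) :=
  Measure.isProbabilityMeasure_map (Measurable.aemeasurable (by fun_prop))

lemma isProbabilityMeasure_iterate_labelledEulerStep (hb : Measurable b) (μ : Measure (Z × 𝔼))
    [IsProbabilityMeasure μ] (k : ℕ) :
    IsProbabilityMeasure ((labelledEulerStep b δ T)^[k] μ) := by
  induction k with
  | zero => assumption
  | succ k ih =>
    rw [Function.iterate_succ_apply']
    exact isProbabilityMeasure_labelledEulerStep hb _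

lemma map_fst_labelledEulerStep (hb : Measurable b) (μ : Measure (Z × 𝔼)) [IsProbabilityMeasure μ] :
    (labelledEulerStep b δ T μ).map Prod.fst = μ.map Prod.fst := by
  refine Measure.ext_of_lintegral _ fun f hf => ?_
  rw [labelledEulerStep, lintegral_map hf measurable_fst, lintegral_map (by fun_prop) (by fun_prop),
    lintegral_prod _ (by fun_prop), lintegral_map hf measurable_fst]
  simp

/-- The label keeps its law, so every step is charged the same transport cost. -/
lemma map_fst_iterate_labelledEulerStep (hb : Measurable b) (μ : Measure (Z × 𝔼)) [IsProbabilityMeasure μ] (k : ℕ) :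
    ((labelledEulerStep b δ T)^[k] μ).map Prod.fst = μ.map Prod.fst := by
  induction k with
  | zero => rfl
  | succ k ih =>
    have := isProbabilityMeasure_iterate_labelledEulerStep hb (δ := δ) (T := T) μ k
    rw [Function.iterate_succ_apply', map_fst_labelledEulerStep hb, ih]

lemma map_snd_labelledEulerStep (hb : Measurable b) (μ : Measure (Z × 𝔼)) [IsProbabilityMeasure μ] :
    (labelledEulerStep b δ T μ).map Prod.snd = (μ.map Prod.snd).bind (eulerKernel b hb δ T) := by
  refine Measure.ext_of_lintegral _ fun f hf => ?_
  rw [labelledEulerStep, lintegral_map hf measurable_snd, lintegral_map (by fun_prop) (by fun_prop),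
    lintegral_prod _ (by fun_prop), Measure.lintegral_bind (Kernel.aemeasurable _) hf.aemeasurable,
    lintegral_map hf.lintegral_kernel measurable_snd]
  refine lintegral_congr fun p => ?_
  change _ = ∫⁻ y, f y ∂((stdGaussian 𝔼).map fun z => p.2 + δ • b p.2 + √(2 * T * δ) • z)
  rw [lintegral_map hf (by fun_prop)]

lemma map_snd_iterate_labelledEulerStep (hb : Measurable b) (μ : Measure (Z × 𝔼)) [IsProbabilityMeasure μ] (k : ℕ) :
    ((labelledEulerStep b δ T)^[k] μ).map Prod.snd =
      (μ.map Prod.snd).bind ⇑(eulerKernel b hb δ T ^ k) := by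
  induction k with
  | zero => exact (Measure.bind_dirac).symm
  | succ k ih =>
    have := isProbabilityMeasure_iterate_labelledEulerStep hb (δ := δ) (T := T) μ k
    rw [Function.iterate_succ_apply', map_snd_labelledEulerStep hb, ih, pow_succ']
    exact Measure.comp_assoc

end LabelledEuler

lemma ProbabilityTheory.Kernel.Invariant.pow {α : Type*} [MeasurableSpace α] {κ : Kernel α α}
    {μ : Measure α} (h : κ.Invariant μ) (n : ℕ) : (κ ^ n).Invariant μ := by
  induction n with
  | zero => exact Measure.bind_dirac
  | succ n ih => rw [pow_succ']; exact h.comp ih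

/-! ### Interpolation between two Euler chains. -/

section ShiftedEuler

variable {d : ℕ}

local notation "𝔼" => EuclideanSpace ℝ (Fin d)

/-- The shift of the current position `w`, labelled by a pair `(x, y)`, by `θ (y - x)`. -/
def interpolationShift (θ : ℝ) (p : (𝔼 × 𝔼) × 𝔼) : (𝔼 × 𝔼) × 𝔼 :=
  (p.1, p.2 + θ • (p.1.2 - p.1.1))

lemma measurable_interpolationShift (θ : ℝ) :
    Measurable (interpolationShift (d := d) θ) := by
  unfold interpolationShift
  fun_prop

variable {b : EuclideanSpace ℝ (Fin d) → EuclideanSpace ℝ (Fin d)} {L δ T : ℝ}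

open InformationTheory in
/-- Entropy production over one step of the Euler scheme when the interpolation parameter moves
from `θ` to `θ'`. -/
lemma klDiv_labelledEulerStep_map_interpolationShift_le (hb : Measurable b)
    (hlip : ∀ x y, ‖b x - b y‖ ≤ L * ‖x - y‖) (hδ : 0 < δ) (hT : 0 < T)
    (μ ρ : Measure ((𝔼 × 𝔼) × 𝔼)) [IsProbabilityMeasure μ] [IsProbabilityMeasure ρ]
    (θ θ' : ℝ) :
    klDiv ((labelledEulerStep b δ T μ).map (interpolationShift θ'))
        (labelledEulerStep b δ T ρ) ≤
      klDiv (μ.map (interpolationShift θ)) ρ +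
        ENNReal.ofReal ((δ * L * |θ| + |θ' - θ|) ^ 2 / (4 * T * δ)) *
          ∫⁻ z, ENNReal.ofReal (‖z.1 - z.2‖ ^ 2) ∂(μ.map Prod.fst) := by
  have hs : 0 < √(2 * T * δ) := Real.sqrt_pos.2 (by positivity)
  have hs2 : √(2 * T * δ) ^ 2 = 2 * T * δ := Real.sq_sqrt (by positivity)
  set s := √(2 * T * δ)
  -- Here `p.2` is the shifted position. The noise must correct the drift, evaluated at the
  -- unshifted position, and supply the change of `θ`; `s⁻¹` converts this to units of the noise.
  let v : (𝔼 × 𝔼) × 𝔼 → 𝔼 := fun p => s⁻¹ • (δ • (b (p.2 - θ • (p.1.2 - p.1.1)) - b p.2) +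
    (θ' - θ) • (p.1.2 - p.1.1))
  have hv : Measurable v := by fun_prop
  let F : ((𝔼 × 𝔼) × 𝔼) × 𝔼 → (𝔼 × 𝔼) × 𝔼 := fun p => (p.1.1, p.1.2 + δ • b p.1.2 + s • p.2)
  have hF : Measurable F := by fun_prop
  have hg := measurable_interpolationShift (d := d) θ
  have hg' := measurable_interpolationShift (d := d) θ'
  have : IsProbabilityMeasure (μ.map (interpolationShift θ)) :=
    Measure.isProbabilityMeasure_map hg.aemeasurable
  have heq : (labelledEulerStep b δ T μ).map (interpolationShift θ') =
      ((μ.map (interpolationShift θ)).prod (stdGaussian 𝔼)).map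
        (fun p => F (p.1, p.2 + v p.1)) := by
    have hprod := Measure.map_prod_map μ (stdGaussian 𝔼) hg measurable_id
    rw [Measure.map_id] at hprod
    rw [hprod, Measure.map_map (by fun_prop) (by fun_prop), labelledEulerStep,
      Measure.map_map hg' (by fun_prop)]
    congr 1
    ext1 p
    simp only [Function.comp_def, interpolationShift, F, v, Prod.map, id, smul_add,
      smul_inv_smul₀ hs.ne', add_sub_cancel_right]
    congr 1
    module
  have hbound (p : (𝔼 × 𝔼) × 𝔼) : ‖v p‖ ^ 2 / 2 ≤
      (δ * L * |θ| + |θ' - θ|) ^ 2 / (4 * T * δ) * ‖p.1.1 - p.1.2‖ ^ 2 := by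
    have h1 : ‖δ • (b (p.2 - θ • (p.1.2 - p.1.1)) - b p.2) + (θ' - θ) • (p.1.2 - p.1.1)‖ ≤
        (δ * L * |θ| + |θ' - θ|) * ‖p.1.1 - p.1.2‖ := by
      refine (norm_add_le _ _).trans ?_
      rw [norm_smul, norm_smul, Real.norm_of_nonneg hδ.le, Real.norm_eq_abs,
        norm_sub_rev p.1.1]
      have := hlip (p.2 - θ • (p.1.2 - p.1.1)) p.2
      rw [sub_sub_cancel_left, norm_neg, norm_smul, Real.norm_eq_abs] at this
      nlinarith
    have h2 : ‖v p‖ ^ 2 / 2 =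
        ‖δ • (b (p.2 - θ • (p.1.2 - p.1.1)) - b p.2) + (θ' - θ) • (p.1.2 - p.1.1)‖ ^ 2 /
          (4 * T * δ) := by
      simp only [v]
      rw [norm_smul, norm_inv, Real.norm_of_nonneg hs.le, mul_pow, inv_pow, hs2]
      field_simp
      ring
    rw [h2, div_mul_eq_mul_div, ← mul_pow]
    gcongr
  rw [heq]
  refine (klDiv_map_prod_stdGaussian_shift_le _ ρ hv hF).trans ?_
  gcongr
  rw [← lintegral_const_mul _ (by fun_prop), lintegral_map (by fun_prop) hg,
    lintegral_map (by fun_prop) measurable_fst]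
  refine lintegral_mono fun p => ?_
  rw [← ENNReal.ofReal_mul (by positivity)]
  exact ENNReal.ofReal_le_ofReal (hbound (interpolationShift θ p))

open InformationTheory in
/-- Entropy–cost inequality for the Euler scheme and an arbitrary coupling of the initial laws. -/
lemma klDiv_bind_eulerKernel_pow_le_lintegral (hb : Measurable b) (hL : 0 ≤ L)
    (hlip : ∀ x y, ‖b x - b y‖ ≤ L * ‖x - y‖) (hδ : 0 < δ) (hT : 0 < T)
    (γ : Measure (𝔼 × 𝔼)) [IsProbabilityMeasure γ] {n : ℕ} (hn : 0 < n) :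
    klDiv ((γ.map Prod.fst).bind ⇑(eulerKernel b hb δ T ^ n))
        ((γ.map Prod.snd).bind ⇑(eulerKernel b hb δ T ^ n)) ≤
      ENNReal.ofReal (1 / (2 * T) * (n * δ * L ^ 2 + 1 / (n * δ))) *
        ∫⁻ z, ENNReal.ofReal (‖z.1 - z.2‖ ^ 2) ∂γ := by
  have hn' : (0 : ℝ) < n := by exact_mod_cast hn
  let α : Measure ((𝔼 × 𝔼) × 𝔼) := γ.map fun z => (z, z.1)
  let β : Measure ((𝔼 × 𝔼) × 𝔼) := γ.map fun z => (z, z.2)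
  have hα : IsProbabilityMeasure α := Measure.isProbabilityMeasure_map (by fun_prop)
  have hβ : IsProbabilityMeasure β := Measure.isProbabilityMeasure_map (by fun_prop)
  have hα1 : α.map Prod.fst = γ := by
    rw [Measure.map_map (by fun_prop) (by fun_prop)]; exact Measure.map_id
  have hα2 : α.map Prod.snd = γ.map Prod.fst := Measure.map_map (by fun_prop) (by fun_prop)
  have hβ2 : β.map Prod.snd = γ.map Prod.snd := Measure.map_map (by fun_prop) (by fun_prop)
  let θ : ℕ → ℝ := fun k => 1 - k / n
  set I := ∫⁻ z, ENNReal.ofReal (‖z.1 - z.2‖ ^ 2) ∂γ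
  set a : ℝ := (δ * L + 1 / n) ^ 2 / (4 * T * δ)
  have key (k : ℕ) (hk : k ≤ n) :
      klDiv (((labelledEulerStep b δ T)^[k] α).map (interpolationShift (θ k)))
        ((labelledEulerStep b δ T)^[k] β) ≤ k * (ENNReal.ofReal a * I) := by
    induction k with
    | zero =>
      have : α.map (interpolationShift (θ 0)) = β := by
        rw [Measure.map_map (measurable_interpolationShift _) (by fun_prop)]
        congr 1
        ext1 z
        simp [interpolationShift, θ]
      simp [this]
    | succ k ih =>
      have h1 := isProbabilityMeasure_iterate_labelledEulerStep hb (δ := δ) (T := T) α k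
      have h2 := isProbabilityMeasure_iterate_labelledEulerStep hb (δ := δ) (T := T) β k
      rw [Function.iterate_succ_apply', Function.iterate_succ_apply']
      refine (klDiv_labelledEulerStep_map_interpolationShift_le hb hlip hδ hT _ _
        (θ k) (θ (k + 1))).trans ?_
      rw [map_fst_iterate_labelledEulerStep hb, hα1]
      push_cast
      rw [add_mul, one_mul]
      have hkn : (k : ℝ) / n ≤ 1 := by
        rw [div_le_one hn']; exact_mod_cast (Nat.le_succ k).trans hk
      have hk0 : (0 : ℝ) ≤ k / n := by positivity
      have hθ : |θ k| ≤ 1 := abs_le.2 ⟨by simp only [θ]; linarith, by simp only [θ]; linarith⟩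
      have hθ' : |θ (k + 1) - θ k| = 1 / n := by
        have : θ (k + 1) - θ k = -(1 / n) := by simp only [θ]; push_cast; ring
        rw [this, abs_neg, abs_of_pos (by positivity)]
      gcongr
      · exact ih ((Nat.le_succ k).trans hk)
      · simp only [a]
        rw [hθ']
        have : δ * L * |θ k| ≤ δ * L := mul_le_of_le_one_right (by positivity) hθ
        gcongr
  have hθn : interpolationShift (d := d) (θ n) = id := by
    ext1 p
    simp [interpolationShift, θ, hn'.ne']
  have hfin := key n le_rfl
  rw [hθn, Measure.map_id] at hfin
  rw [← hα2, ← hβ2, ← map_snd_iterate_labelledEulerStep hb, ← map_snd_iterate_labelledEulerStep hb]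
  have h1 := isProbabilityMeasure_iterate_labelledEulerStep hb (δ := δ) (T := T) α n
  have h2 := isProbabilityMeasure_iterate_labelledEulerStep hb (δ := δ) (T := T) β n
  refine (klDiv_map_le _ _ measurable_snd).trans (hfin.trans ?_)
  rw [← mul_assoc, ← ENNReal.ofReal_natCast, ← ENNReal.ofReal_mul hn'.le]
  refine mul_le_mul' (ENNReal.ofReal_le_ofReal ?_) le_rfl
  -- This inequality separates the drift cost, of order `n * δ`, from the cost of moving `θ`, of
  -- order `1 / (n * δ)`.
  have hsq : (δ * L + 1 / n) ^ 2 ≤ 2 * ((δ * L) ^ 2 + (1 / (n : ℝ)) ^ 2) := add_sq_le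
  calc n * a ≤ n * (2 * ((δ * L) ^ 2 + (1 / (n : ℝ)) ^ 2) / (4 * T * δ)) := by
        simp only [a]; gcongr
    _ = 1 / (2 * T) * (n * δ * L ^ 2 + 1 / (n * δ)) := by
        field_simp
        ring

end ShiftedEuler

theorem mainTheorem8 {d : ℕ}
    (b : EuclideanSpace ℝ (Fin d) → EuclideanSpace ℝ (Fin d))
    (Lb C c δ T : ℝ) (hLb : 0 < Lb) (hC : 0 < C) (hc : 0 < c) (hδ : 0 < δ) (hT : 0 < T)
    (hlip : ∀ x y, ‖b x - b y‖ ≤ Lb * ‖x - y‖)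
    (hdiff : Differentiable ℝ b)
    (hgrad : ∀ x y, ‖fderiv ℝ b x - fderiv ℝ b y‖ ≤ C * ‖x - y‖)
    (hδ_le : δ ≤ 1 / (16 * c * Lb ^ 2 * Real.exp (2 * c * Lb)))
    (πinf : Measure (EuclideanSpace ℝ (Fin d))) [IsProbabilityMeasure πinf]
    (hinv : (eulerKernel b hdiff.continuous.measurable δ T).Invariant πinf)
    (ν : Measure (EuclideanSpace ℝ (Fin d))) [IsProbabilityMeasure ν]
    (n : ℕ) (hn : 2 ≤ n) (hnδ : (n : ℝ) * δ < c) :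
    InformationTheory.klDiv
        (ν.bind ⇑(eulerKernel b hdiff.continuous.measurable δ T ^ n)) πinf ≤
      ENNReal.ofReal
          ((1 / (2 * T)) * (n * δ * Lb ^ 2 + 1 / (n * δ))
            + (1 / 2) * c ^ 2 * C ^ 2 * d * Real.exp (2 * c * Lb))
        * wassersteinDist 2 ν πinf ^ 2 := by
  have hn' : (0 : ℝ) < n := by exact_mod_cast (by omega : 0 < n)
  have hW : wassersteinDist 2 ν πinf ^ 2 =
      ⨅ γ ∈ couplings ν πinf, ∫⁻ z, edist z.1 z.2 ^ (2 : ℝ) ∂γ := by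
    rw [wassersteinDist, ← ENNReal.rpow_natCast, ← ENNReal.rpow_mul]
    norm_num
  have hpos : 0 < (1 / (2 * T)) * (n * δ * Lb ^ 2 + 1 / (n * δ))
      + (1 / 2) * c ^ 2 * C ^ 2 * d * Real.exp (2 * c * Lb) := by positivity
  -- A zero constant would not pass through the infimum: the inner one is `∞` when `γ` is not a
  -- coupling, and `0 * ∞ = 0`.
  have hne : ENNReal.ofReal ((1 / (2 * T)) * (n * δ * Lb ^ 2 + 1 / (n * δ))
      + (1 / 2) * c ^ 2 * C ^ 2 * d * Real.exp (2 * c * Lb)) ≠ 0 :=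
    (ENNReal.ofReal_pos.2 hpos).ne'
  rw [hW, ENNReal.mul_iInf_of_ne hne ENNReal.ofReal_ne_top]
  refine le_iInf fun γ => ?_
  rw [ENNReal.mul_iInf_of_ne hne ENNReal.ofReal_ne_top]
  refine le_iInf fun hγ => ?_
  have hγp : IsProbabilityMeasure γ := by
    have : IsProbabilityMeasure (γ.map Prod.fst) := by rw [hγ.1]; infer_instance
    exact Measure.isProbabilityMeasure_of_map Prod.fst
  have h := klDiv_bind_eulerKernel_pow_le_lintegral hdiff.continuous.measurable hLb.le hlip hδ hT γ
    (n := n) (by omega)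
  rw [hγ.1, hγ.2, (hinv.pow n).def] at h
  refine h.trans (mul_le_mul' (ENNReal.ofReal_le_ofReal ?_) (lintegral_mono fun z => ?_))
  · have : 0 ≤ (1 / 2) * c ^ 2 * C ^ 2 * d * Real.exp (2 * c * Lb) := by positivity
    linarith
  · rw [edist_dist, dist_eq_norm, ENNReal.ofReal_rpow_of_nonneg (norm_nonneg _) zero_le_two,
      Real.rpow_two]
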